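/- Let $\mathcal{G}=(V,E)$ be a finite connected simple graph with $r=|V|\ge 2$ vertices, let $N(i)$ be the set of neighbours of $i\in V$, let $\Delta_{r-1}=\{x\in\mathbf{R}^V_{\ge 0}:\sum_{i\in V}x_i=1\}$, and let $\alpha>0$. Consider the diffusion on $\Delta_{r-1}$ given by $$dx_i=\sum_{j\in N(i)}\sqrt{x_ix_j}\,dB_{ij}+\frac{\alpha}{2}(1-rx_i)\,dt,\qquad i\in V,$$ where the $B_{ij}=-B_{ji}$ ($i\sim j$) are standard Brownian motions, independent for distinct edges. Its generator is $$\tilde Lf=\frac12\sum_{i,j\in V}\sigma_{ij}(x)\frac{\partial^2 f}{\partial x_i\partial x_j}+\frac{\alpha}{2}\sum_{i\in V}(1-rx_i)\frac{\partial f}{\partial x_i},$$ with $\sigma_{ii}(x)=x_i\sum_{j\in N(i)}x_j$, $\sigma_{ij}(x)=-x_ix_j$ if $i\sim j$, and $\sigma_{ij}(x)=0$ otherwise. Let $\{\tilde T_t:t\ge0\}$ be a strongly continuous Markov semigroup on $C(\Delta_{r-1})$ associated with this diffusion, that is, $\tilde T_t1=1$, $\tilde T_tf\ge0$ whenever $f\ge0$,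 and $\tilde T_tf-f=\int_0^t\tilde T_s\tilde Lf\,ds$ for all $t\ge 0$ and all $f\in C^2(\Delta_{r-1})$. Let $\{\tilde T_t^*\}$ be the adjoint semigroup on the Borel probability measures on $\Delta_{r-1}$, defined by $\langle\tilde T_t^*\mu,f\rangle=\langle\mu,\tilde T_tf\rangle$ for $f\in C(\Delta_{r-1})$; a stationary state is a probability measure $\mu$ with $\tilde T_t^*\mu=\mu$ for all $t\ge0$. Then there is exactly one stationary state $\nu_\alpha$, and all of its moments are positive: $$m_a(\alpha):=\langle\nu_\alpha,x^a\rangle=\int_{\Delta_{r-1}}\prod_{i\in V}x_i^{a_i}\,\nu_\alpha(dx)>0\qquad\text{for every } a\in\mathbf{N}_0^V .$$ -/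

import Mathlib

open MeasureTheory
open scoped NNReal

noncomputable section

namespace GraphDiffusion

variable {V : Type*} [Fintype V] [DecidableEq V]

/-- The first partial derivative `∂f/∂xᵢ`. -/
def partialDeriv (i : V) (f : (V → ℝ) → ℝ) (x : V → ℝ) : ℝ :=
  fderiv ℝ f x (Pi.single i 1)

/-- The diffusion matrix `σ(x)` of `dxᵢ = ∑_{j ∈ N(i)} √(xᵢ xⱼ) dB_{ij}` with skew-symmetric
Brownian motions: `σᵢᵢ = xᵢ ∑_{j ∈ N(i)} xⱼ`, `σᵢⱼ = - xᵢ xⱼ` for `i ∼ j`, and `0` otherwise. -/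
def diffusionMatrix (G : SimpleGraph V) [DecidableRel G.Adj] (x : V → ℝ) (i j : V) : ℝ :=
  if i = j then x i * ∑ k ∈ G.neighborFinset i, x k
  else if G.Adj i j then -(x i * x j) else 0

/-- The generator of the diffusion with linear drift
`dxᵢ = ∑_{j ∈ N(i)} √(xᵢ xⱼ) dB_{ij} + (α/2)(1 - r xᵢ) dt`, where `r = |V|`. -/
def driftGenerator (G : SimpleGraph V) [DecidableRel G.Adj] (α : ℝ)
    (f : (V → ℝ) → ℝ) (x : V → ℝ) : ℝ :=
  (1 / 2) * ∑ i, ∑ j, diffusionMatrix G x i j * partialDeriv i (partialDeriv j f) x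
    + ∑ i, (α / 2) * (1 - (Fintype.card V : ℝ) * x i) * partialDeriv i f x

theorem contDiff_partialDeriv {n m : WithTop ℕ∞} (hnm : m + 1 ≤ n) (i : V)
    {f : (V → ℝ) → ℝ} (hf : ContDiff ℝ n f) : ContDiff ℝ m (partialDeriv i f) :=
  (hf.fderiv_right hnm).clm_apply contDiff_const

theorem continuous_diffusionMatrix (G : SimpleGraph V) [DecidableRel G.Adj] (i j : V) :
    Continuous fun x : V → ℝ => diffusionMatrix G x i j := by
  unfold diffusionMatrix
  split_ifs <;> fun_prop

theorem continuous_driftGenerator (G : SimpleGraph V) [DecidableRel G.Adj] (α : ℝ)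
    {f : (V → ℝ) → ℝ} (hf : ContDiff ℝ 2 f) : Continuous (driftGenerator G α f) := by
  have h1 : ∀ i, ContDiff ℝ 1 (partialDeriv i f) := fun i =>
    contDiff_partialDeriv (by norm_num) i hf
  have h2 : ∀ i j, Continuous (partialDeriv i (partialDeriv j f)) := fun i j =>
    (contDiff_partialDeriv (m := 0) (by norm_num) i (h1 j)).continuous
  have h3 : ∀ i, Continuous (partialDeriv i f) := fun i => (h1 i).continuous
  have h4 := continuous_diffusionMatrix G
  unfold driftGenerator
  fun_prop

/-- Restriction of a continuous function on `ℝ^V` to the simplex `Δ_{r-1}`. -/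
def restrict (f : (V → ℝ) → ℝ) (hf : Continuous f) : C(stdSimplex ℝ V, ℝ) :=
  ⟨fun x => f x, hf.comp continuous_subtype_val⟩

/-- A strongly continuous Markov semigroup `(T_t)_{t ≥ 0}` on `C(Δ_{r-1})` associated with the
diffusion with linear drift. A `C²` function on the (closed, hence compact) simplex is the
restriction of a `C²` function on `ℝ^V`; on the simplex, the generator only involves
derivatives along the simplex. -/
structure IsDriftSemigroup (G : SimpleGraph V) [DecidableRel G.Adj] (α : ℝ)
    (T : ℝ≥0 → C(stdSimplex ℝ V, ℝ) →L[ℝ] C(stdSimplex ℝ V, ℝ)) : Prop where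
  map_zero : T 0 = ContinuousLinearMap.id ℝ _
  map_add : ∀ s t, T (s + t) = (T s).comp (T t)
  strongly_continuous : ∀ f, Continuous fun t => T t f
  map_one : ∀ t, T t 1 = 1
  nonneg : ∀ t f, 0 ≤ f → 0 ≤ T t f
  generator : ∀ (f : (V → ℝ) → ℝ) (hf : ContDiff ℝ 2 f) (t : ℝ≥0),
    T t (restrict f hf.continuous) - restrict f hf.continuous =
      ∫ s in (0 : ℝ)..t,
        T s.toNNReal (restrict (driftGenerator G α f) (continuous_driftGenerator G α hf))

/-- `μ' = T_t^* μ` for the adjoint semigroup on probability measures, i.e.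
`⟨μ', f⟩ = ⟨μ, T_t f⟩` for all `f ∈ C(Δ_{r-1})`. -/
def IsAdjointImage (T : ℝ≥0 → C(stdSimplex ℝ V, ℝ) →L[ℝ] C(stdSimplex ℝ V, ℝ)) (t : ℝ≥0)
    (μ μ' : ProbabilityMeasure (stdSimplex ℝ V)) : Prop :=
  ∀ f : C(stdSimplex ℝ V, ℝ),
    ∫ x, f x ∂(μ' : Measure (stdSimplex ℝ V)) = ∫ x, T t f x ∂(μ : Measure (stdSimplex ℝ V))

/-- A stationary state of the adjoint semigroup: `T_t^* μ = μ` for all `t ≥ 0`. -/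
def IsStationaryState (T : ℝ≥0 → C(stdSimplex ℝ V, ℝ) →L[ℝ] C(stdSimplex ℝ V, ℝ))
    (μ : ProbabilityMeasure (stdSimplex ℝ V)) : Prop :=
  ∀ t, IsAdjointImage T t μ μ

/-- The moment `⟨μ, x^a⟩`. -/
def moment (μ : ProbabilityMeasure (stdSimplex ℝ V)) (a : V → ℕ) : ℝ :=
  ∫ x, ∏ i, (x : V → ℝ) i ^ a i ∂(μ : Measure (stdSimplex ℝ V))

end GraphDiffusion

end

/-! Existence is the Krylov–Bogoliubov argument: time averages of an orbit, taken along an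
ultrafilter, converge to an invariant positive normalized functional, which Riesz representation
turns into a measure.

Uniqueness comes from moments. Integrating the generator applied to `x^a` against a stationary state
gives, writing `e_i` for `Pi.single i 1`, `(∑_{i, j ∼ i} a_i a_j + α r |a|) m_a = ∑_{i, j ∼ i} a_i
(a_i - 1) m_{a - e_i + e_j} + α ∑_i a_i m_{a - e_i}`. The drift sum has lower degree, so by
induction on `|a|` the difference `d` of two moment families solves the homogeneous system in its
degree. Rows of that system need not be diagonally dominant. Dividing row `a` by `a!`, however,
makes the off-diagonal column sums exactly `∑ a_i a_j / a!`, so the columns are strictly dominant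
with excess `α r |a| / a!`, and `d = 0` (`eq_zero_of_moment_equations`). By Stone–Weierstrass the
moments determine the measure (`eq_of_moment_eq`).

Positivity follows from the same equation: its right side has nonnegative terms, and the drift sum
is positive by induction. -/

noncomputable section

/-! ### Existence of a stationary state -/

namespace GraphDiffusion

open Filter Topology

/-- A positive normalized linear functional on the continuous functions on a compact space is
integration against a probability measure. -/
theorem exists_probabilityMeasure_integral_eq {X : Type*} [TopologicalSpace X] [T2Space X]
    [CompactSpace X] [MeasurableSpace X] [BorelSpace X] (Λ : C(X, ℝ) →ₗ[ℝ] ℝ)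
    (hpos : ∀ f, 0 ≤ f → 0 ≤ Λ f) (hone : Λ 1 = 1) :
    ∃ ν : ProbabilityMeasure X, ∀ f : C(X, ℝ), ∫ x, f x ∂(ν : Measure X) = Λ f := by
  let Φ : CompactlySupportedContinuousMap X ℝ →ₚ[ℝ] ℝ := PositiveLinearMap.mk₀
    { toFun := fun f => Λ f.toContinuousMap
      map_add' := fun f g => Λ.map_add f.toContinuousMap g.toContinuousMap
      map_smul' := fun c f => Λ.map_smul c f.toContinuousMap }
    (fun f hf => hpos _ fun x => hf x)
  have key : ∀ f : C(X, ℝ), ∫ x, f x ∂(RealRMK.rieszMeasure Φ) = Λ f := fun f =>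
    RealRMK.integral_rieszMeasure Φ ⟨f, HasCompactSupport.of_compactSpace f⟩
  have h1 := key 1
  rw [hone] at h1
  have hprob : IsProbabilityMeasure (RealRMK.rieszMeasure Φ) := by
    constructor
    have h2 : (RealRMK.rieszMeasure Φ).real Set.univ = 1 := by simpa using h1
    rw [Measure.real, ENNReal.toReal_eq_one_iff] at h2
    exact h2
  exact ⟨⟨RealRMK.rieszMeasure Φ, hprob⟩, key⟩

/-- Integration of continuous functions on a compact space, as a continuous linear functional. -/
def integralCLM {X : Type*} [TopologicalSpace X] [CompactSpace X] [MeasurableSpace X]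
    [BorelSpace X] (μ : Measure X) [IsProbabilityMeasure μ] : C(X, ℝ) →L[ℝ] ℝ :=
  LinearMap.mkContinuous
    { toFun := fun f => ∫ x, f x ∂μ
      map_add' := fun f g => integral_add
        (f.continuous.integrable_of_hasCompactSupport (HasCompactSupport.of_compactSpace _))
        (g.continuous.integrable_of_hasCompactSupport (HasCompactSupport.of_compactSpace _))
      map_smul' := fun c f => integral_const_mul c _ } 1 fun f => by
    simpa using norm_integral_le_of_norm_le_const (μ := μ) (ae_of_all _ f.norm_coe_le_norm)

/-- A pointwise bounded sequence of linear functionals converges pointwise along an ultrafilter. -/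
theorem exists_linearMap_tendsto {E : Type*} [AddCommGroup E] [Module ℝ E]
    (A : ℕ → E →ₗ[ℝ] ℝ) (C : E → ℝ) (hA : ∀ n f, |A n f| ≤ C f) (U : Ultrafilter ℕ) :
    ∃ Λ : E →ₗ[ℝ] ℝ, ∀ f, Tendsto (fun n => A n f) U (𝓝 (Λ f)) := by
  have h : ∀ f, ∃ l, Tendsto (fun n => A n f) U (𝓝 l) := fun f => by
    obtain ⟨l, -, hl⟩ := (isCompact_Icc (a := -C f) (b := C f)).ultrafilter_le_nhds'
      (U.map fun n => A n f) (by
        change (fun n => A n f) ⁻¹' _ ∈ U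
        exact univ_mem' fun n => abs_le.1 (hA n f))
    exact ⟨l, hl⟩
  choose l hl using h
  refine ⟨{ toFun := l, map_add' := fun f g => ?_, map_smul' := fun c f => ?_ }, hl⟩
  · refine tendsto_nhds_unique (hl (f + g)) ?_
    simpa using (hl f).add (hl g)
  · refine tendsto_nhds_unique (hl (c • f)) ?_
    simpa using (hl f).const_mul c

variable {V : Type*} [Fintype V] [DecidableEq V]

namespace IsDriftSemigroup

variable {G : SimpleGraph V} [DecidableRel G.Adj] {α : ℝ}
  {T : ℝ≥0 → C(stdSimplex ℝ V, ℝ) →L[ℝ] C(stdSimplex ℝ V, ℝ)}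

/-- Positivity of `T t` applied to `‖f‖ • 1 ± f`, together with `T t 1 = 1`. -/
theorem abs_apply_le (hT : IsDriftSemigroup G α T) (t : ℝ≥0) (f : C(stdSimplex ℝ V, ℝ))
    (x : stdSimplex ℝ V) : |T t f x| ≤ ‖f‖ := by
  have h1 := hT.nonneg t (‖f‖ • 1 - f) fun y => by
    simpa using (le_abs_self _).trans (f.norm_coe_le_norm y)
  have h2 := hT.nonneg t (‖f‖ • 1 + f) fun y => by
    have := (neg_abs_le _).trans' (neg_le_neg (f.norm_coe_le_norm y))
    simp
    linarith
  rw [_root_.map_sub, map_smul, hT.map_one] at h1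
  rw [_root_.map_add, map_smul, hT.map_one] at h2
  have h1x := h1 x
  have h2x := h2 x
  simp at h1x h2x
  exact abs_le.2 ⟨by linarith, h1x⟩

theorem continuous_orbit (hT : IsDriftSemigroup G α T) (f : C(stdSimplex ℝ V, ℝ))
    (x : stdSimplex ℝ V) : Continuous fun s : ℝ => T s.toNNReal f x :=
  (ContinuousEvalConst.continuous_eval_const x).comp
    ((hT.strongly_continuous f).comp continuous_real_toNNReal)

/-- The time average of the orbit of an observable over `[0, n]`. -/
def timeAverage (hT : IsDriftSemigroup G α T) (x : stdSimplex ℝ V) (n : ℕ) :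
    C(stdSimplex ℝ V, ℝ) →ₗ[ℝ] ℝ where
  toFun f := (n : ℝ)⁻¹ * ∫ s in (0 : ℝ)..n, T s.toNNReal f x
  map_add' f g := by
    simp only [_root_.map_add, ContinuousMap.add_apply]
    rw [intervalIntegral.integral_add ((hT.continuous_orbit f x).intervalIntegrable _ _)
      ((hT.continuous_orbit g x).intervalIntegrable _ _), mul_add]
  map_smul' c f := by
    simp only [map_smul, ContinuousMap.smul_apply, smul_eq_mul, RingHom.id_apply,
      intervalIntegral.integral_const_mul]
    ring

theorem timeAverage_apply (hT : IsDriftSemigroup G α T) (x : stdSimplex ℝ V) (n : ℕ)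
    (f : C(stdSimplex ℝ V, ℝ)) :
    hT.timeAverage x n f = (n : ℝ)⁻¹ * ∫ s in (0 : ℝ)..n, T s.toNNReal f x := rfl

theorem abs_timeAverage_le (hT : IsDriftSemigroup G α T) (x : stdSimplex ℝ V) (n : ℕ)
    (f : C(stdSimplex ℝ V, ℝ)) : |hT.timeAverage x n f| ≤ ‖f‖ := by
  rw [timeAverage_apply, abs_mul, abs_of_nonneg (by positivity : (0 : ℝ) ≤ (n : ℝ)⁻¹)]
  have h := intervalIntegral.norm_integral_le_of_norm_le_const (a := (0 : ℝ)) (b := n)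
    (f := fun s => T s.toNNReal f x) (C := ‖f‖) fun s _ => hT.abs_apply_le _ f x
  rw [Real.norm_eq_abs, sub_zero, Nat.abs_cast] at h
  rcases n.eq_zero_or_pos with rfl | hn
  · simp
  · rw [inv_mul_le_iff₀ (by positivity), mul_comm]
    exact h

/-- Replacing `f` by `T t f` shifts the time window by `t`; the two windows differ by two intervals
of length `t`, each contributing at most `t * ‖f‖`. -/
theorem abs_timeAverage_apply_sub_le (hT : IsDriftSemigroup G α T) (x : stdSimplex ℝ V) (n : ℕ)
    (t : ℝ≥0) (f : C(stdSimplex ℝ V, ℝ)) :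
    |hT.timeAverage x n (T t f) - hT.timeAverage x n f| ≤ 2 * t * ‖f‖ * (n : ℝ)⁻¹ := by
  have hint : ∀ a b, IntervalIntegrable (fun s : ℝ => T s.toNNReal f x) volume a b :=
    fun a b => (hT.continuous_orbit f x).intervalIntegrable a b
  have hbound : ∀ a : ℝ, |∫ s in a..a + t, T s.toNNReal f x| ≤ ‖f‖ * t := fun a => by
    simpa using intervalIntegral.norm_integral_le_of_norm_le_const (a := a) (b := a + t)
      (f := fun s => T s.toNNReal f x) (C := ‖f‖) fun s _ => hT.abs_apply_le _ f x
  have hshift : ∫ s in (0 : ℝ)..n, T s.toNNReal (T t f) x =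
      ∫ s in (0 : ℝ) + t..n + t, T s.toNNReal f x := by
    rw [← intervalIntegral.integral_comp_add_right fun s : ℝ => T s.toNNReal f x]
    refine intervalIntegral.integral_congr fun s hs => ?_
    rw [Set.uIcc_of_le (Nat.cast_nonneg n)] at hs
    have ht : (s + t).toNNReal = s.toNNReal + t := by
      rw [Real.toNNReal_add hs.1 t.coe_nonneg, Real.toNNReal_coe]
    simp only [ht, hT.map_add, ContinuousLinearMap.comp_apply]
  have hdiff : (∫ s in (0 : ℝ) + t..n + t, T s.toNNReal f x) -
      ∫ s in (0 : ℝ)..n, T s.toNNReal f x =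
      (∫ s in (n : ℝ)..n + t, T s.toNNReal f x) - ∫ s in (0 : ℝ)..0 + t, T s.toNNReal f x := by
    have h1 := intervalIntegral.integral_add_adjacent_intervals (hint 0 (0 + t))
      (hint (0 + t) (n + t))
    have h2 := intervalIntegral.integral_add_adjacent_intervals (hint 0 n) (hint n (n + t))
    linarith
  rw [timeAverage_apply, timeAverage_apply, ← mul_sub, hshift, hdiff, abs_mul,
    abs_of_nonneg (by positivity : (0 : ℝ) ≤ (n : ℝ)⁻¹), mul_comm]
  gcongr
  refine (abs_sub _ _).trans ?_
  linarith [hbound n, hbound 0]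

/-- A stationary state exists, by averaging in time (Krylov and Bogoliubov). -/
theorem exists_isStationaryState [Nonempty V] (hT : IsDriftSemigroup G α T) :
    ∃ ν : ProbabilityMeasure (stdSimplex ℝ V), IsStationaryState T ν := by
  obtain ⟨x⟩ : Nonempty (stdSimplex ℝ V) := inferInstance
  obtain ⟨Λ, hΛ⟩ := exists_linearMap_tendsto (hT.timeAverage x) (fun f => ‖f‖)
    (hT.abs_timeAverage_le x) (hyperfilter ℕ)
  have hle : (hyperfilter ℕ : Filter ℕ) ≤ atTop := Nat.hyperfilter_le_atTop
  have hpos : ∀ f, 0 ≤ f → 0 ≤ Λ f := fun f hf => ge_of_tendsto' (hΛ f) fun n => by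
    rw [timeAverage_apply]
    exact mul_nonneg (by positivity) (intervalIntegral.integral_nonneg (by positivity)
      fun s _ => hT.nonneg _ f hf x)
  have hone : Λ 1 = 1 := by
    refine tendsto_nhds_unique (hΛ 1) (tendsto_const_nhds.congr' ?_)
    -- At `n = 0` the average vanishes because `0⁻¹ = 0`, so normalization holds only from `n = 1`
    -- on.
    filter_upwards [hle (eventually_ge_atTop 1)] with n hn
    have : (n : ℝ) ≠ 0 := by positivity
    simp [timeAverage_apply, hT.map_one, this]
  have hinv : ∀ t f, Λ (T t f) = Λ f := fun t f => by
    have h0 : Tendsto (fun n : ℕ => 2 * t * ‖f‖ * (n : ℝ)⁻¹) (hyperfilter ℕ) (𝓝 0) := by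
      have := (tendsto_inv_atTop_nhds_zero_nat (𝕜 := ℝ)).const_mul (2 * t * ‖f‖)
      rw [mul_zero] at this
      exact this.mono_left hle
    have h1 := squeeze_zero_norm (f := fun n => hT.timeAverage x n (T t f) -
      hT.timeAverage x n f) (fun n => hT.abs_timeAverage_apply_sub_le x n t f) h0
    exact sub_eq_zero.1 (tendsto_nhds_unique ((hΛ (T t f)).sub (hΛ f)) h1)
  obtain ⟨ν, hν⟩ := exists_probabilityMeasure_integral_eq Λ hpos hone
  exact ⟨ν, fun t f => by rw [hν, ← hinv t f, ← hν]⟩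

/-- The generator has mean zero under a stationary state. -/
theorem integral_driftGenerator_eq_zero (hT : IsDriftSemigroup G α T)
    {μ : ProbabilityMeasure (stdSimplex ℝ V)} (hμ : IsStationaryState T μ)
    {f : (V → ℝ) → ℝ} (hf : ContDiff ℝ 2 f) :
    ∫ x : stdSimplex ℝ V, driftGenerator G α f x ∂(μ : Measure (stdSimplex ℝ V)) = 0 := by
  let I := integralCLM (μ : Measure (stdSimplex ℝ V))
  let g := restrict (driftGenerator G α f) (continuous_driftGenerator G α hf)
  have hI : ∀ t h, I (T t h) = I h := fun t h => (hμ t h).symm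
  -- By stationarity the left side integrates to zero and the integrand on the right is constant in
  -- time.
  have h1 := congrArg I (hT.generator f hf 1)
  have hc : Continuous fun s : ℝ => T s.toNNReal g :=
    (hT.strongly_continuous g).comp continuous_real_toNNReal
  rw [map_sub, hI, sub_self, ← I.intervalIntegral_comp_comm (hc.intervalIntegrable _ _)] at h1
  simp only [hI, intervalIntegral.integral_const] at h1
  rw [sub_zero, NNReal.coe_one, one_smul] at h1
  exact h1.symm

end IsDriftSemigroup
end GraphDiffusion

/-! ### The generator on monomials -/

namespace GraphDiffusion

variable {V : Type*}

theorem single_le_of_ne_zero [DecidableEq V] {a : V → ℕ} {i : V} (h : a i ≠ 0) :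
    Pi.single i 1 ≤ a := by
  intro j
  by_cases hj : j = i
  · subst hj; simpa using Nat.one_le_iff_ne_zero.2 h
  · simp [hj]

variable [Fintype V]

/-- The monomial `x^a`. -/
def monomialFun (a : V → ℕ) (x : V → ℝ) : ℝ := ∏ i, x i ^ a i

theorem contDiff_monomialFun {n : WithTop ℕ∞} (a : V → ℕ) : ContDiff ℝ n (monomialFun a) := by
  unfold monomialFun
  fun_prop

theorem monomialFun_nonneg (a : V → ℕ) (x : stdSimplex ℝ V) : 0 ≤ monomialFun a x :=
  Finset.prod_nonneg fun i _ => pow_nonneg (x.2.1 i) _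

theorem monomialFun_zero : monomialFun (0 : V → ℕ) = 1 := by
  funext x
  simp [monomialFun]

theorem monomialFun_add (a b : V → ℕ) (x : V → ℝ) :
    monomialFun (a + b) x = monomialFun a x * monomialFun b x := by
  simp [monomialFun, pow_add, Finset.prod_mul_distrib]

variable [DecidableEq V]

theorem monomialFun_single (i : V) (x : V → ℝ) : monomialFun (Pi.single i 1) x = x i := by
  simp [monomialFun, Pi.single_apply, pow_ite]

theorem partialDeriv_monomialFun (i : V) (a : V → ℕ) :
    partialDeriv i (monomialFun a) =
      fun x => (a i : ℝ) * monomialFun (a - Pi.single i 1) x := by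
  funext x
  have h := HasFDerivAt.finsetProd (u := Finset.univ) (x := x)
    (g := fun (j : V) (y : V → ℝ) => y j ^ a j)
    (g' := fun j => (a j * x j ^ (a j - 1)) • ContinuousLinearMap.proj (R := ℝ) j)
    fun j _ => by simpa using (hasFDerivAt_apply (𝕜 := ℝ) j x).pow (a j)
  have h' : HasFDerivAt (monomialFun a) _ x := h
  rw [partialDeriv, h'.fderiv]
  simp only [sum_apply, smul_apply,
    ContinuousLinearMap.proj_apply, smul_eq_mul]
  rw [Finset.sum_eq_single i (fun j _ hj => by simp [hj]) (by simp)]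
  rw [monomialFun, ← Finset.mul_prod_erase _ _ (Finset.mem_univ i)]
  have : ∏ j ∈ Finset.univ.erase i, x j ^ (a - Pi.single i 1 : V → ℕ) j =
      ∏ j ∈ Finset.univ.erase i, x j ^ a j :=
    Finset.prod_congr rfl fun j hj => by simp [Finset.ne_of_mem_erase hj]
  rw [this]
  simp
  ring

theorem partialDeriv_const_mul_monomialFun (i : V) (a : V → ℕ) (c : ℝ) :
    partialDeriv i (fun x => c * monomialFun a x) =
      fun x => c * ((a i : ℝ) * monomialFun (a - Pi.single i 1) x) := by
  funext x
  rw [← congrFun (partialDeriv_monomialFun i a) x, partialDeriv, partialDeriv,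
    fderiv_const_mul ((contDiff_monomialFun (n := 1) a).differentiable (by simp) x)]
  simp

/-- When `a i = 0` the subtraction truncates, but the factor `a i` kills the term. -/
theorem mul_monomialFun_sub_single (a : V → ℕ) (i : V) (x : V → ℝ) :
    (a i : ℝ) * (x i * monomialFun (a - Pi.single i 1) x) = a i * monomialFun a x := by
  by_cases h : a i = 0
  · simp [h]
  · rw [← monomialFun_single i x, ← monomialFun_add,
      add_tsub_cancel_of_le (single_le_of_ne_zero h)]

theorem diffusionMatrix_self_mul_partialDeriv (G : SimpleGraph V) [DecidableRel G.Adj]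
    (a : V → ℕ) (i : V) (x : V → ℝ) :
    diffusionMatrix G x i i * partialDeriv i (partialDeriv i (monomialFun a)) x =
      ∑ j ∈ G.neighborFinset i, (a i : ℝ) * (a i - 1) *
        monomialFun (a - Pi.single i 1 + Pi.single j 1) x := by
  rw [partialDeriv_monomialFun, partialDeriv_const_mul_monomialFun]
  have h := mul_monomialFun_sub_single (a - Pi.single i 1) i x
  have hc : (a i : ℝ) * ((a - Pi.single i 1 : V → ℕ) i : ℕ) = a i * (a i - 1) := by
    rcases Nat.eq_zero_or_pos (a i) with h0 | h0
    · simp [h0]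
    · simp [Nat.cast_sub (Nat.succ_le_of_lt h0)]
  simp only [diffusionMatrix, if_true, monomialFun_add, monomialFun_single]
  rw [← hc, ← Finset.mul_sum, ← Finset.mul_sum]
  linear_combination (a i * ∑ k ∈ G.neighborFinset i, x k) * h

theorem diffusionMatrix_mul_partialDeriv_of_ne (G : SimpleGraph V) [DecidableRel G.Adj]
    (a : V → ℕ) {i j : V} (hij : i ≠ j) (x : V → ℝ) :
    diffusionMatrix G x i j * partialDeriv i (partialDeriv j (monomialFun a)) x =
      if G.Adj i j then -((a i : ℝ) * a j * monomialFun a x) else 0 := by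
  rw [partialDeriv_monomialFun, partialDeriv_const_mul_monomialFun]
  have h1 := mul_monomialFun_sub_single (a - Pi.single j 1) i x
  have h2 := mul_monomialFun_sub_single a j x
  have hc : (a - Pi.single j 1 : V → ℕ) i = a i := by simp [hij]
  rw [hc] at h1 ⊢
  simp only [diffusionMatrix, if_neg hij]
  split_ifs
  · linear_combination (-(x j * a j)) * h1 - a i * h2
  · simp

/-- No term exceeds the degree of `x^a`: diffusion preserves it, drift preserves it or lowers it by
one. Hence the moment equations close degree by degree. -/
theorem driftGenerator_monomialFun (G : SimpleGraph V) [DecidableRel G.Adj] (α : ℝ)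
    (a : V → ℕ) (x : V → ℝ) :
    driftGenerator G α (monomialFun a) x =
      (1 / 2) * (∑ i, ∑ j ∈ G.neighborFinset i,
          ((a i : ℝ) * (a i - 1) * monomialFun (a - Pi.single i 1 + Pi.single j 1) x
            - a i * a j * monomialFun a x))
        + (α / 2) * (∑ i, (a i : ℝ) * monomialFun (a - Pi.single i 1) x
            - Fintype.card V * (∑ i, a i : ℕ) * monomialFun a x) := by
  have h1 : ∀ i, ∑ j, diffusionMatrix G x i j * partialDeriv i (partialDeriv j (monomialFun a)) x
      = ∑ j ∈ G.neighborFinset i,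
          ((a i : ℝ) * (a i - 1) * monomialFun (a - Pi.single i 1 + Pi.single j 1) x
            - a i * a j * monomialFun a x) := fun i => by
    rw [← Finset.add_sum_erase _ _ (Finset.mem_univ i), diffusionMatrix_self_mul_partialDeriv,
      Finset.sum_sub_distrib, sub_eq_add_neg (∑ j ∈ _, _), ← Finset.sum_neg_distrib]
    congr 1
    rw [Finset.sum_congr rfl fun j hj => diffusionMatrix_mul_partialDeriv_of_ne G a
      (Finset.ne_of_mem_erase hj).symm x, ← Finset.sum_filter]
    refine Finset.sum_congr ?_ fun _ _ => rfl
    ext j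
    simp only [Finset.mem_filter, Finset.mem_erase, Finset.mem_univ, and_true,
      SimpleGraph.mem_neighborFinset, and_iff_right_iff_imp]
    exact fun h => h.ne'
  rw [driftGenerator, Finset.sum_congr rfl fun i _ => h1 i]
  congr 1
  push_cast
  rw [Finset.mul_sum, Finset.sum_mul, ← Finset.sum_sub_distrib, Finset.mul_sum]
  refine Finset.sum_congr rfl fun i _ => ?_
  rw [partialDeriv_monomialFun]
  linear_combination (-(α / 2 * Fintype.card V)) * mul_monomialFun_sub_single a i x

end GraphDiffusion

/-! ### Moment equations and determinacy by moments -/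

namespace GraphDiffusion

open scoped Nat

variable {V : Type*} [Fintype V]

theorem integrable_monomialFun (μ : ProbabilityMeasure (stdSimplex ℝ V)) (a : V → ℕ) :
    Integrable (fun x : stdSimplex ℝ V => monomialFun a x) (μ : Measure (stdSimplex ℝ V)) :=
  (restrict (monomialFun a) (contDiff_monomialFun (n := 0) a).continuous).continuous
    |>.integrable_of_hasCompactSupport (HasCompactSupport.of_compactSpace _)

theorem moment_eq_integral_monomialFun (μ : ProbabilityMeasure (stdSimplex ℝ V)) (a : V → ℕ) :
    moment μ a = ∫ x : stdSimplex ℝ V, monomialFun a x ∂(μ : Measure (stdSimplex ℝ V)) := rfl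

theorem moment_nonneg (μ : ProbabilityMeasure (stdSimplex ℝ V)) (a : V → ℕ) : 0 ≤ moment μ a :=
  integral_nonneg fun x => monomialFun_nonneg a x

theorem moment_zero (μ : ProbabilityMeasure (stdSimplex ℝ V)) : moment μ 0 = 1 := by
  simp [moment]

variable [DecidableEq V]

theorem prod_factorial_add_single (c : V → ℕ) (i : V) :
    ∏ k, ((c + Pi.single i 1 : V → ℕ) k)! = (c i + 1) * ∏ k, (c k)! := by
  rw [← Finset.mul_prod_erase _ _ (Finset.mem_univ i),
    ← Finset.mul_prod_erase _ (fun k => (c k)!) (Finset.mem_univ i), ← mul_assoc]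
  congr 1
  · simp [Nat.factorial_succ]
  · exact Finset.prod_congr rfl fun k hk => by simp [Finset.ne_of_mem_erase hk]

theorem sum_add_single (c : V → ℕ) (i : V) :
    ∑ k, (c + Pi.single i 1 : V → ℕ) k = ∑ k, c k + 1 := by
  simp [Finset.sum_add_distrib]

theorem sum_sub_single {a : V → ℕ} {i : V} (h : a i ≠ 0) :
    ∑ k, (a - Pi.single i 1 : V → ℕ) k + 1 = ∑ k, a k := by
  rw [← sum_add_single _ i, tsub_add_cancel_of_le (single_le_of_ne_zero h)]

/-- After division by `a!`, moving one particle from `i` to `j` at rate `aᵢ(aᵢ - 1)` has the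
column sums `aᵢ aⱼ`. -/
theorem sum_piAntidiag_transport (f : (V → ℕ) → ℝ) (n : ℕ) {i j : V} (hij : i ≠ j) :
    ∑ a ∈ Finset.piAntidiag Finset.univ n,
        (a i : ℝ) * (a i - 1) * f (a - Pi.single i 1 + Pi.single j 1) / (∏ k, (a k)! : ℕ) =
      ∑ b ∈ Finset.piAntidiag Finset.univ n, (b i : ℝ) * b j * f b / (∏ k, (b k)! : ℕ) := by
  -- The shift is injective only where `a i ≠ 0`, which holds on the nonzero terms.
  refine Finset.sum_bij_ne_zero (fun a _ _ => a - Pi.single i 1 + Pi.single j 1) ?_ ?_ ?_ ?_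
  · intro a ha h
    have hi : a i ≠ 0 := fun h0 => h (by simp [h0])
    rw [Finset.mem_piAntidiag] at ha ⊢
    refine ⟨?_, by simp⟩
    rw [sum_add_single, sum_sub_single hi, ha.1]
  · intro a ha h a' ha' h' heq
    have hi : a i ≠ 0 := fun h0 => h (by simp [h0])
    have hi' : a' i ≠ 0 := fun h0 => h' (by simp [h0])
    rw [← tsub_add_cancel_of_le (single_le_of_ne_zero hi),
      ← tsub_add_cancel_of_le (single_le_of_ne_zero hi'), add_right_cancel heq]
  · intro b hb h
    have hj : b j ≠ 0 := fun h0 => h (by simp [h0])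
    have hi : b i ≠ 0 := fun h0 => h (by simp [h0])
    have hb' : b - Pi.single j 1 + Pi.single i 1 - Pi.single i 1 + Pi.single j 1 = b := by
      rw [add_tsub_cancel_right, tsub_add_cancel_of_le (single_le_of_ne_zero hj)]
    have hf : f b ≠ 0 := fun h0 => h (by simp [h0])
    refine ⟨b - Pi.single j 1 + Pi.single i 1, ?_, ?_, hb'⟩
    · rw [Finset.mem_piAntidiag] at hb ⊢
      refine ⟨?_, by simp⟩
      rw [sum_add_single, sum_sub_single hj, hb.1]
    · rw [hb']
      refine div_ne_zero (mul_ne_zero ?_ hf) (by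
        exact_mod_cast (Finset.prod_pos fun k _ => Nat.factorial_pos _).ne')
      -- The coefficient at the preimage is `(b i + 1) * b i`.
      simp only [Pi.add_apply, Pi.sub_apply, Pi.single_eq_same, Pi.single_eq_of_ne hij]
      push_cast
      simp only [tsub_zero, add_sub_cancel_right]
      exact_mod_cast mul_ne_zero (Nat.succ_ne_zero _) hi
  · intro a ha h
    have hi : a i ≠ 0 := fun h0 => h (by simp [h0])
    obtain ⟨c, rfl⟩ : ∃ c : V → ℕ, a = c + Pi.single i 1 :=
      ⟨a - Pi.single i 1, (tsub_add_cancel_of_le (single_le_of_ne_zero hi)).symm⟩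
    -- With `a = c + e_i` and image `c + e_j`, both weights reduce to `c_i / c!`.
    rw [add_tsub_cancel_right, prod_factorial_add_single, prod_factorial_add_single]
    have hc : ((∏ k, (c k)! : ℕ) : ℝ) ≠ 0 := by
      exact_mod_cast (Finset.prod_pos fun k _ => Nat.factorial_pos _).ne'
    have h1 : ((c i : ℝ) + 1) ≠ 0 := by positivity
    have h2 : ((c j : ℝ) + 1) ≠ 0 := by positivity
    simp only [Pi.add_apply, Pi.single_eq_same, Pi.single_eq_of_ne hij]
    push_cast at hc ⊢
    field_simp
    ring

/-- The homogeneous moment equations in a fixed degree only have the zero solution: after division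
by `a!` their matrix is strictly diagonally dominant by columns. -/
theorem eq_zero_of_moment_equations (G : SimpleGraph V) [DecidableRel G.Adj]
    (d : (V → ℕ) → ℝ) (n : ℕ) {c : ℝ} (hc : 0 < c)
    (h : ∀ a : V → ℕ, ∑ i, a i = n →
      (∑ i, ∑ j ∈ G.neighborFinset i, (a i : ℝ) * a j + c) * d a =
        ∑ i, ∑ j ∈ G.neighborFinset i,
          (a i : ℝ) * (a i - 1) * d (a - Pi.single i 1 + Pi.single j 1))
    (a : V → ℕ) (ha : ∑ i, a i = n) : d a = 0 := by
  let S : Finset (V → ℕ) := Finset.piAntidiag Finset.univ n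
  have hS : ∀ a, a ∈ S ↔ ∑ i, a i = n := fun a => by simp [S]
  have hw : ∀ a : V → ℕ, (0 : ℝ) < (∏ k, (a k)! : ℕ) := fun a => by
    exact_mod_cast Finset.prod_pos fun k _ => Nat.factorial_pos _
  have hcoef : ∀ m : ℕ, (0 : ℝ) ≤ m * (m - 1) := fun m => by
    rcases m.eq_zero_or_pos with rfl | hm
    · simp
    · have : (1 : ℝ) ≤ m := by exact_mod_cast hm
      exact mul_nonneg (by positivity) (by linarith)
  have h1 : ∀ a ∈ S,
      (∑ i, ∑ j ∈ G.neighborFinset i, (a i : ℝ) * a j * |d a| / (∏ k, (a k)! : ℕ)) +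
        c * |d a| / (∏ k, (a k)! : ℕ) ≤
      ∑ i, ∑ j ∈ G.neighborFinset i, (a i : ℝ) * (a i - 1) *
        |d (a - Pi.single i 1 + Pi.single j 1)| / (∏ k, (a k)! : ℕ) := fun a ha => by
    simp only [← Finset.sum_div, ← add_div, ← Finset.sum_mul, ← add_mul]
    refine div_le_div_of_nonneg_right ?_ (hw a).le
    have hnn : 0 ≤ ∑ i, ∑ j ∈ G.neighborFinset i, (a i : ℝ) * a j + c := by positivity
    rw [← abs_of_nonneg hnn, ← abs_mul, h a ((hS a).1 ha)]
    refine (Finset.abs_sum_le_sum_abs _ _).trans (Finset.sum_le_sum fun i _ => ?_)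
    refine (Finset.abs_sum_le_sum_abs _ _).trans (Finset.sum_le_sum fun j _ => ?_)
    rw [abs_mul, abs_of_nonneg (hcoef _)]
  have h2 := Finset.sum_le_sum h1
  have hcomm : ∀ F : V → V → (V → ℕ) → ℝ,
      ∑ a ∈ S, ∑ i, ∑ j ∈ G.neighborFinset i, F i j a =
        ∑ i, ∑ j ∈ G.neighborFinset i, ∑ a ∈ S, F i j a := fun F => by
    rw [Finset.sum_comm]
    exact Finset.sum_congr rfl fun i _ => Finset.sum_comm
  have h3 : ∑ a ∈ S, ∑ i, ∑ j ∈ G.neighborFinset i, (a i : ℝ) * (a i - 1) *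
        |d (a - Pi.single i 1 + Pi.single j 1)| / (∏ k, (a k)! : ℕ) =
      ∑ a ∈ S, ∑ i, ∑ j ∈ G.neighborFinset i, (a i : ℝ) * a j * |d a| / (∏ k, (a k)! : ℕ) := by
    refine (hcomm fun i j a => (a i : ℝ) * (a i - 1) *
        |d (a - Pi.single i 1 + Pi.single j 1)| / (∏ k, (a k)! : ℕ)).trans (Eq.trans ?_
      (hcomm fun i j a => (a i : ℝ) * a j * |d a| / (∏ k, (a k)! : ℕ)).symm)
    refine Finset.sum_congr rfl fun i _ => Finset.sum_congr rfl fun j hj => ?_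
    exact sum_piAntidiag_transport (fun b => |d b|) n
      ((SimpleGraph.mem_neighborFinset _ _ _).1 hj).ne
  -- Transport and diagonal sums cancel, leaving `∑ c * |d a| / a! ≤ 0`.
  rw [h3, Finset.sum_add_distrib, add_le_iff_nonpos_right] at h2
  have hnn : ∀ b ∈ S, 0 ≤ c * |d b| / (∏ k, (b k)! : ℕ) := fun b _ => by positivity
  have h4 := (Finset.sum_eq_zero_iff_of_nonneg hnn).1 (le_antisymm h2 (Finset.sum_nonneg hnn))
    a ((hS a).2 ha)
  simpa [hc.ne', (hw a).ne'] using (div_eq_zero_iff.1 h4).resolve_right (hw a).ne'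

/-- The moment equations of a stationary state. -/
theorem IsDriftSemigroup.moment_equation {G : SimpleGraph V} [DecidableRel G.Adj] {α : ℝ}
    {T : ℝ≥0 → C(stdSimplex ℝ V, ℝ) →L[ℝ] C(stdSimplex ℝ V, ℝ)} (hT : IsDriftSemigroup G α T)
    {μ : ProbabilityMeasure (stdSimplex ℝ V)} (hμ : IsStationaryState T μ) (a : V → ℕ) :
    (∑ i, ∑ j ∈ G.neighborFinset i, (a i : ℝ) * a j
        + α * (Fintype.card V * (∑ i, a i : ℕ))) * moment μ a =
      ∑ i, ∑ j ∈ G.neighborFinset i,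
          (a i : ℝ) * (a i - 1) * moment μ (a - Pi.single i 1 + Pi.single j 1)
        + α * ∑ i, (a i : ℝ) * moment μ (a - Pi.single i 1) := by
  have h := hT.integral_driftGenerator_eq_zero hμ (contDiff_monomialFun a)
  have hi := integrable_monomialFun μ
  simp only [driftGenerator_monomialFun] at h
  have h1 : ∀ i j, Integrable (fun x : stdSimplex ℝ V =>
      (a i : ℝ) * (a i - 1) * monomialFun (a - Pi.single i 1 + Pi.single j 1) x
        - a i * a j * monomialFun a x) (μ : Measure (stdSimplex ℝ V)) := fun i j =>
    ((hi _).const_mul _).sub ((hi _).const_mul _)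
  have h2 : ∀ i, Integrable (fun x : stdSimplex ℝ V =>
      (a i : ℝ) * monomialFun (a - Pi.single i 1) x) (μ : Measure (stdSimplex ℝ V)) :=
    fun i => (hi _).const_mul _
  have h3 := integrable_finsetSum Finset.univ fun i _ =>
    integrable_finsetSum (G.neighborFinset i) fun j _ => h1 i j
  have h4 := integrable_finsetSum Finset.univ fun i _ => h2 i
  have h6 : Integrable (fun x : stdSimplex ℝ V =>
      ∑ i, (a i : ℝ) * monomialFun (a - Pi.single i 1) x
      - Fintype.card V * (∑ i, a i : ℕ) * monomialFun a x) (μ : Measure (stdSimplex ℝ V)) :=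
    h4.sub ((hi a).const_mul _)
  rw [integral_add (h3.const_mul _) (h6.const_mul _),
    integral_const_mul, integral_const_mul, integral_sub h4 ((hi a).const_mul _),
    integral_finsetSum _ fun i _ => integrable_finsetSum _ fun j _ => h1 i j,
    integral_finsetSum _ fun i _ => h2 i] at h
  simp only [integral_const_mul, ← moment_eq_integral_monomialFun] at h
  have h5 : ∀ i, ∫ x : stdSimplex ℝ V, ∑ j ∈ G.neighborFinset i,
      ((a i : ℝ) * (a i - 1) * monomialFun (a - Pi.single i 1 + Pi.single j 1) x
        - a i * a j * monomialFun a x) ∂(μ : Measure (stdSimplex ℝ V)) =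
      ∑ j ∈ G.neighborFinset i,
        (a i : ℝ) * (a i - 1) * moment μ (a - Pi.single i 1 + Pi.single j 1)
      - (∑ j ∈ G.neighborFinset i, (a i : ℝ) * a j) * moment μ a := fun i => by
    rw [integral_finsetSum _ fun j _ => h1 i j, Finset.sum_mul, ← Finset.sum_sub_distrib]
    refine Finset.sum_congr rfl fun j _ => ?_
    rw [integral_sub ((hi _).const_mul _) ((hi _).const_mul _), integral_const_mul,
      integral_const_mul]
    rfl
  rw [Finset.sum_congr rfl fun i _ => h5 i, Finset.sum_sub_distrib, ← Finset.sum_mul] at h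
  linear_combination -2 * h

/-- A probability measure on the simplex is determined by its moments. -/
theorem eq_of_moment_eq {μ ν : ProbabilityMeasure (stdSimplex ℝ V)}
    (h : ∀ a, moment μ a = moment ν a) : μ = ν := by
  let X : V → C(stdSimplex ℝ V, ℝ) := fun i => restrict (fun x => x i) (continuous_apply i)
  let I := integralCLM (μ : Measure (stdSimplex ℝ V))
  let J := integralCLM (ν : Measure (stdSimplex ℝ V))
  have hX : ∀ p ∈ Submonoid.closure (Set.range X), ∃ a : V → ℕ,
      p = restrict (monomialFun a) (contDiff_monomialFun (n := 0) a).continuous := by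
    intro p hp
    induction hp using Submonoid.closure_induction with
    | mem p hp =>
      obtain ⟨i, rfl⟩ := hp
      refine ⟨Pi.single i 1, ?_⟩
      ext x
      exact (monomialFun_single i x).symm
    | one =>
      refine ⟨0, ?_⟩
      ext x
      exact (congrFun monomialFun_zero x).symm
    | mul p q _ _ hp hq =>
      obtain ⟨a, rfl⟩ := hp
      obtain ⟨b, rfl⟩ := hq
      refine ⟨a + b, ?_⟩
      ext x
      exact (monomialFun_add a b x).symm
  have hA : ∀ p ∈ Algebra.adjoin ℝ (Set.range X), I p = J p := by
    intro p hp
    -- The generated algebra is the span of the monoid generated by the coordinates, whose elements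
    -- are monomials.
    rw [← Subalgebra.mem_toSubmodule, Algebra.adjoin_eq_span] at hp
    refine LinearMap.eqOn_span (f := I.toLinearMap) (g := J.toLinearMap) (fun q hq => ?_) hp
    obtain ⟨a, rfl⟩ := hX q hq
    exact h a
  have hsep : (Algebra.adjoin ℝ (Set.range X)).SeparatesPoints := by
    intro x y hxy
    obtain ⟨i, hi⟩ : ∃ i, (x : V → ℝ) i ≠ (y : V → ℝ) i := by
      by_contra hcon
      push Not at hcon
      exact hxy (Subtype.ext (funext hcon))
    exact ⟨X i, ⟨X i, Algebra.subset_adjoin ⟨i, rfl⟩, rfl⟩, hi⟩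
  have hdense : Dense (Algebra.adjoin ℝ (Set.range X) : Set C(stdSimplex ℝ V, ℝ)) := by
    rw [dense_iff_closure_eq, ← Subalgebra.topologicalClosure_coe,
      ContinuousMap.subalgebra_topologicalClosure_eq_top_of_separatesPoints _ hsep]
    rfl
  have hIJ : ⇑I = ⇑J := Continuous.ext_on hdense I.continuous J.continuous hA
  refine ProbabilityMeasure.toMeasure_injective
    (ext_of_forall_integral_eq_of_IsFiniteMeasure fun f => ?_)
  exact congrFun hIJ f.toContinuousMap

/-! ### Uniqueness and positivity of the moments -/

namespace IsDriftSemigroup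

variable {G : SimpleGraph V} [DecidableRel G.Adj] {α : ℝ}
  {T : ℝ≥0 → C(stdSimplex ℝ V, ℝ) →L[ℝ] C(stdSimplex ℝ V, ℝ)}

theorem moment_eq_of_isStationaryState [Nonempty V] (hT : IsDriftSemigroup G α T) (hα : 0 < α)
    {μ ν : ProbabilityMeasure (stdSimplex ℝ V)} (hμ : IsStationaryState T μ)
    (hν : IsStationaryState T ν) (n : ℕ) :
    ∀ a : V → ℕ, ∑ i, a i = n → moment μ a = moment ν a := by
  induction n with
  | zero =>
    intro a ha
    have : a = 0 := by ext i; simpa using (Finset.sum_eq_zero_iff.1 ha) i (Finset.mem_univ i)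
    rw [this, moment_zero, moment_zero]
  | succ n ih =>
    intro a ha
    -- The strict excess of the diagonal, supplied by the drift in degree `n + 1`; in degree zero
    -- total mass fixes the moment.
    have hc : 0 < α * (Fintype.card V * ((n + 1 : ℕ) : ℝ)) := by
      have := Fintype.card_pos (α := V)
      positivity
    refine sub_eq_zero.1 (eq_zero_of_moment_equations G (fun b => moment μ b - moment ν b)
      (n + 1) hc (fun b hb => ?_) a ha)
    have h1 := hT.moment_equation hμ b
    have h2 := hT.moment_equation hν b
    have h3 : ∑ i, (b i : ℝ) * moment μ (b - Pi.single i 1) =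
        ∑ i, (b i : ℝ) * moment ν (b - Pi.single i 1) := by
      refine Finset.sum_congr rfl fun i _ => ?_
      by_cases hi : b i = 0
      · simp [hi]
      · rw [ih _ (by have := sum_sub_single hi; omega)]
    rw [hb] at h1 h2
    rw [mul_sub]
    simp only [mul_sub ((b _ : ℝ) * (b _ - 1)), Finset.sum_sub_distrib]
    rw [h3] at h1
    linarith

theorem moment_pos [Nonempty V] (hT : IsDriftSemigroup G α T) (hα : 0 < α)
    {μ : ProbabilityMeasure (stdSimplex ℝ V)} (hμ : IsStationaryState T μ) (n : ℕ) :
    ∀ a : V → ℕ, ∑ i, a i = n → 0 < moment μ a := by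
  induction n with
  | zero =>
    intro a ha
    have : a = 0 := by ext i; simpa using (Finset.sum_eq_zero_iff.1 ha) i (Finset.mem_univ i)
    rw [this, moment_zero]
    exact one_pos
  | succ n ih =>
    intro a ha
    obtain ⟨k, hk⟩ : ∃ k, a k ≠ 0 := by
      by_contra hcon
      push Not at hcon
      simp [hcon] at ha
    have h := hT.moment_equation hμ a
    have h1 : 0 ≤ ∑ i, ∑ j ∈ G.neighborFinset i,
        (a i : ℝ) * (a i - 1) * moment μ (a - Pi.single i 1 + Pi.single j 1) := by
      refine Finset.sum_nonneg fun i _ => Finset.sum_nonneg fun j _ =>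
        mul_nonneg ?_ (moment_nonneg _ _)
      rcases (a i).eq_zero_or_pos with h0 | h0
      · simp [h0]
      · have : (1 : ℝ) ≤ a i := by exact_mod_cast h0
        exact mul_nonneg (by positivity) (by linarith)
    -- Removing one factor `x_k` with `a k ≠ 0` gives a moment of degree `n`, positive by induction.
    have h2 : 0 < ∑ i, (a i : ℝ) * moment μ (a - Pi.single i 1) := by
      refine Finset.sum_pos' (fun i _ => mul_nonneg (by positivity) (moment_nonneg _ _))
        ⟨k, Finset.mem_univ k, mul_pos (by positivity) (ih _ ?_)⟩
      have := sum_sub_single hk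
      omega
    have h3 := add_pos_of_nonneg_of_pos h1 (mul_pos hα h2)
    rw [← h] at h3
    exact pos_of_mul_pos_right h3 (by positivity)

end IsDriftSemigroup
end GraphDiffusion
end

theorem mainTheorem11 {V : Type*} [Fintype V] [DecidableEq V]
    (G : SimpleGraph V) [DecidableRel G.Adj]
    (hG : G.Connected) (hr : 2 ≤ Fintype.card V) (α : ℝ) (hα : 0 < α)
    (T : ℝ≥0 → C(stdSimplex ℝ V, ℝ) →L[ℝ] C(stdSimplex ℝ V, ℝ))
    (hT : GraphDiffusion.IsDriftSemigroup G α T) :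
    ∃ ν : ProbabilityMeasure (stdSimplex ℝ V),
      GraphDiffusion.IsStationaryState T ν ∧
      (∀ μ : ProbabilityMeasure (stdSimplex ℝ V),
        GraphDiffusion.IsStationaryState T μ → μ = ν) ∧
      ∀ a : V → ℕ, 0 < GraphDiffusion.moment ν a := by
  have : Nonempty V := hG.nonempty
  obtain ⟨ν, hν⟩ := hT.exists_isStationaryState
  exact ⟨ν, hν, fun μ hμ => GraphDiffusion.eq_of_moment_eq fun a =>
    hT.moment_eq_of_isStationaryState hα hμ hν _ a rfl, fun a => hT.moment_pos hα hν _ a rfl⟩
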